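/- All rings are commutative. For a noetherian local ring $R$ with maximal ideal $\mathfrak m$ and a finitely generated $R$-module $M$ with minimal free resolution $F$, filter $F$ by the subcomplexes $\mathcal G^nF$ with $(\mathcal G^nF)_i=\mathfrak m^{n-i}F_i$ (where $\mathfrak m^j=R$ for $j\le 0$), and let $\operatorname{lin}^RF$ be the associated graded complex $\bigoplus_n \mathcal G^nF/\mathcal G^{n+1}F$. The linearity defect of $M$ is $\operatorname{lind}_RM=\sup\{i: H_i(\operatorname{lin}^RF)\ne 0\}\in\mathbb N\cup\{\infty\}$, with $\operatorname{lind}_R 0=0$; $M$ is a Koszul module if $\operatorname{lind}_RM=0$. Put $\operatorname{glind} R=\sup\{\operatorname{lind}_RM : M \text{ a finitely generated } R\text{-module}\}$, and call $R$ absolutely Koszul if $\operatorname{lind}_RM<\infty$ for every finitely generated $R$-module $M$. **Theorem.** Let $R\to S$ be a surjective homomorphism of noetherian local rings such that $\operatorname{lind}_RS=0$, that is, $S$ is a Koszul $R$-module. Then $\operatorname{lind}_RN=\operatorname{lind}_SN$ for every finitely generated $S$-module $N$. In particular, $\operatorname{glind} S\le\operatorname{glind} R$; and if $R$ is absolutely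 Koszul, then so is $S$. -/

import Mathlib

open IsLocalRing

namespace LinearityDefect

universe u v

/-- A minimal free resolution `⋯ ⟶ F₁ ⟶ F₀ ⟶ M ⟶ 0` of a module `M` over a local ring `R`,
with finitely generated free modules `F i = R ^ (rank i)`: it is exact, and the differential
maps `F (i + 1)` into `𝔪 F i`. -/
structure MinimalFreeResolution (R : Type u) [CommRing R] [IsLocalRing R]
    (M : Type v) [AddCommGroup M] [Module R M] where
  /-- the Betti numbers -/
  rank : ℕ → ℕ
  /-- the differential `F (i + 1) ⟶ F i` -/
  d (i : ℕ) : (Fin (rank (i + 1)) → R) →ₗ[R] (Fin (rank i) → R)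
  /-- the augmentation `F 0 ⟶ M` -/
  aug : (Fin (rank 0) → R) →ₗ[R] M
  aug_surjective : Function.Surjective aug
  exact_zero : Function.Exact (d 0) aug
  exact_succ (i : ℕ) : Function.Exact (d (i + 1)) (d i)
  minimal (i : ℕ) :
    LinearMap.range (d i) ≤ maximalIdeal R • (⊤ : Submodule R (Fin (rank i) → R))

namespace MinimalFreeResolution

variable {R : Type u} [CommRing R] [IsLocalRing R] {M : Type v} [AddCommGroup M] [Module R M]
  (F : MinimalFreeResolution R M)

/-- The filtration `(𝓖ⁿ F)ᵢ = 𝔪 ^ (n - i) Fᵢ`, where `𝔪 ^ j = R` for `j ≤ 0` (this is what the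
truncated subtraction gives). Negative `n` are not needed, since `(𝓖ⁿ F)ᵢ = Fᵢ` for `n ≤ i`. -/
def filtration (n i : ℕ) : Submodule R (Fin (F.rank i) → R) :=
  maximalIdeal R ^ (n - i) • ⊤

/-- The differential respects the filtration. -/
theorem d_mem_filtration (n i : ℕ) (x : Fin (F.rank (i + 1)) → R)
    (hx : x ∈ F.filtration n (i + 1)) : F.d i x ∈ F.filtration n i := by
  have h1 : F.d i x ∈ (F.filtration n (i + 1)).map (F.d i) := Submodule.mem_map_of_mem hx
  rw [filtration, Submodule.map_smul'', Submodule.map_top] at h1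
  have h2 := (smul_mono_right (maximalIdeal R ^ (n - (i + 1))) (F.minimal i)) h1
  rw [← mul_smul, ← pow_succ] at h2
  exact Submodule.smul_mono_left (Ideal.pow_le_pow_right (by omega)) h2

/-- The component `(𝓖ⁿ F)ᵢ / (𝓖ⁿ⁺¹ F)ᵢ` of the associated graded complex. -/
def gr (n i : ℕ) : Type u :=
  F.filtration n i ⧸ (F.filtration (n + 1) i).submoduleOf (F.filtration n i)

instance (n i : ℕ) : AddCommGroup (F.gr n i) :=
  inferInstanceAs (AddCommGroup
    (F.filtration n i ⧸ (F.filtration (n + 1) i).submoduleOf (F.filtration n i)))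

instance (n i : ℕ) : Module R (F.gr n i) :=
  inferInstanceAs (Module R
    (F.filtration n i ⧸ (F.filtration (n + 1) i).submoduleOf (F.filtration n i)))

/-- The map `(𝓖ⁿ F)ᵢ₊₁ / (𝓖ⁿ⁺¹ F)ᵢ₊₁ ⟶ (𝓖ⁿ F)ᵢ / (𝓖ⁿ⁺¹ F)ᵢ` induced by the differential. -/
def grD (n i : ℕ) : F.gr n (i + 1) →ₗ[R] F.gr n i :=
  Submodule.mapQ ((F.filtration (n + 1) (i + 1)).submoduleOf (F.filtration n (i + 1)))
    ((F.filtration (n + 1) i).submoduleOf (F.filtration n i))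
    ((F.d i).restrict (F.d_mem_filtration n i))
    (fun x hx => F.d_mem_filtration (n + 1) i x hx)

/-- The term in homological degree `i` of the linear part of `F`, that is, of the associated
graded complex of the filtration `𝓖`. -/
abbrev linPart (i : ℕ) : Type u := DirectSum ℕ (fun n => F.gr n i)

/-- The differential of the linear part of `F`. -/
def linD (i : ℕ) : F.linPart (i + 1) →ₗ[R] F.linPart i :=
  DirectSum.lmap (fun n => F.grD n i)

/-- The cycles in homological degree `i` of the linear part of `F`. -/
def linCycles : (i : ℕ) → Submodule R (F.linPart i)
  | 0 => ⊤
  | i + 1 => LinearMap.ker (F.linD i)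

/-- The boundaries in homological degree `i` of the linear part of `F`. -/
def linBoundaries (i : ℕ) : Submodule R (F.linPart i) := LinearMap.range (F.linD i)

/-- The linear part of `F` is a complex. -/
theorem linBoundaries_le_linCycles (i : ℕ) : F.linBoundaries i ≤ F.linCycles i := by
  cases i with
  | zero => exact le_top
  | succ i =>
    rintro _ ⟨x, rfl⟩
    change F.linD i (F.linD (i + 1) x) = 0
    ext n : 1
    simp only [linD, DirectSum.lmap_apply, DirectSum.zero_apply]
    obtain ⟨y, hy⟩ := Submodule.Quotient.mk_surjective _ (x n)
    rw [← hy]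
    refine (Submodule.Quotient.mk_eq_zero _).2 ?_
    change F.d i (F.d (i + 1) y) ∈ F.filtration (n + 1) i
    rw [(F.exact_succ i).apply_apply_eq_zero]
    exact zero_mem _

/-- The homology module `Hᵢ` of the linear part of `F`. -/
abbrev linHomology (i : ℕ) : Type u :=
  F.linCycles i ⧸ (F.linBoundaries i).submoduleOf (F.linCycles i)

end MinimalFreeResolution

/-- Every finitely generated module over a local ring has a minimal free cover. -/
theorem exists_minimal_cover (R : Type u) [CommRing R] [IsLocalRing R]
    (M : Type v) [AddCommGroup M] [Module R M] [Module.Finite R M] :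
    ∃ (b : ℕ) (p : (Fin b → R) →ₗ[R] M), Function.Surjective p ∧
      LinearMap.ker p ≤ maximalIdeal R • (⊤ : Submodule R (Fin b → R)) := by
  classical
  have hex : ∃ b : ℕ, ∃ v : Fin b → M, Submodule.span R (Set.range v) = ⊤ := by
    obtain ⟨n, s, hs⟩ := Module.Finite.exists_fin (R := R) (M := M)
    exact ⟨n, s, hs⟩
  obtain ⟨v, hv⟩ := Nat.find_spec hex
  have hmin := fun m => Nat.find_min hex (m := m)
  generalize Nat.find hex = b at v hv hmin
  refine ⟨b, Fintype.linearCombination R v, ?_, ?_⟩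
  · rw [← LinearMap.range_eq_top, Fintype.range_linearCombination, hv]
  · intro x hx
    have hcoord : ∀ j, x j ∈ maximalIdeal R := by
      intro j
      by_contra hj
      have hu : IsUnit (x j) := by simpa using hj
      obtain _ | c := b
      · exact j.elim0
      · refine hmin c (Nat.lt_succ_self c) ⟨fun i => v (j.succAbove i), ?_⟩
        rw [eq_top_iff, ← hv, Submodule.span_le]
        have hsub : ∀ i, v (j.succAbove i) ∈
            Submodule.span R (Set.range fun i => v (j.succAbove i)) :=
          fun i => Submodule.subset_span ⟨i, rfl⟩
        rintro _ ⟨i, rfl⟩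
        rcases Fin.eq_self_or_eq_succAbove j i with rfl | ⟨k, rfl⟩
        · rw [LinearMap.mem_ker, Fintype.linearCombination_apply, Fin.sum_univ_succAbove _ i,
            add_eq_zero_iff_eq_neg] at hx
          have h1 : x i • v i ∈ Submodule.span R (Set.range fun k => v (i.succAbove k)) := by
            rw [hx]
            exact neg_mem (sum_mem fun k _ => Submodule.smul_mem _ _ (hsub k))
          exact (Submodule.smul_mem_iff_of_isUnit _ hu).1 h1
        · exact hsub k
    rw [pi_eq_sum_univ' x]
    exact sum_mem fun i _ => Submodule.smul_mem_smul (hcoord i) trivial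

/-- Every finitely generated module over a noetherian local ring has a minimal free resolution. -/
theorem nonempty_minimalFreeResolution (R : Type u) [CommRing R] [IsLocalRing R]
    [IsNoetherianRing R] (M : Type v) [AddCommGroup M] [Module R M] [Module.Finite R M] :
    Nonempty (MinimalFreeResolution R M) := by
  choose b p hp hker using fun s : Σ b : ℕ, Submodule R (Fin b → R) =>
    exists_minimal_cover R s.2
  obtain ⟨b₀, p₀, hp₀, hker₀⟩ := exists_minimal_cover R M
  let s : ℕ → Σ b : ℕ, Submodule R (Fin b → R) := fun n =>
    Nat.rec ⟨b₀, LinearMap.ker p₀⟩ (fun _ t => ⟨b t, LinearMap.ker (p t)⟩) n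
  have hs : ∀ n, (s n).2 ≤ maximalIdeal R • (⊤ : Submodule R (Fin (s n).1 → R)) := by
    intro n
    cases n with
    | zero => exact hker₀
    | succ n => exact hker (s n)
  have hr : ∀ n, LinearMap.range ((s n).2.subtype ∘ₗ p (s n)) = (s n).2 := by
    intro n
    rw [LinearMap.range_comp, LinearMap.range_eq_top.2 (hp (s n)), Submodule.map_top,
      Submodule.range_subtype]
  exact ⟨{
    rank := fun n => (s n).1
    d := fun n => (s n).2.subtype ∘ₗ p (s n)
    aug := p₀
    aug_surjective := hp₀
    exact_zero := LinearMap.exact_iff.2 (hr 0).symm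
    exact_succ := fun n => LinearMap.exact_iff.2 <| by
      refine Eq.trans ?_ (hr (n + 1)).symm
      rw [LinearMap.ker_comp, Submodule.ker_subtype, Submodule.comap_bot]
    minimal := fun n => (hr n).trans_le (hs n) }⟩

/-- The linearity defect of `M`: the supremum of the `i` such that `Hᵢ` of the linear part of the
minimal free resolution of `M` is nonzero. Minimal free resolutions are unique up to isomorphism,
so any of them may be used. The supremum is taken in `ℕ∞`, and is `0` for `M = 0`. -/
noncomputable def lind (R : Type u) [CommRing R] [IsLocalRing R]
    (M : Type v) [AddCommGroup M] [Module R M] : ℕ∞ :=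
  sSup {t : ℕ∞ | ∃ (F : MinimalFreeResolution R M) (i : ℕ),
    Nontrivial (F.linHomology i) ∧ t = (i : ℕ∞)}

/-- The global linearity defect of `R`: the supremum of the linearity defects of the finitely
generated `R`-modules (up to isomorphism these all live in the universe of `R`). -/
noncomputable def glind (R : Type u) [CommRing R] [IsLocalRing R] : ℕ∞ :=
  sSup {t : ℕ∞ | ∃ M : ModuleCat.{u} R, Module.Finite R M ∧ t = lind R M}

/-- `R` is absolutely Koszul if every finitely generated `R`-module has finite linearity
defect. -/
def IsAbsolutelyKoszul (R : Type u) [CommRing R] [IsLocalRing R] : Prop :=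
  ∀ (M : Type u) [AddCommGroup M] [Module R M], Module.Finite R M → lind R M < ⊤

end LinearityDefect

/-! The linearity defect is first read off the syzygies: `lind R M ≤ d` holds exactly when every
syzygy `K` of `M` in degrees `j ≥ d`, inside its free cover `P`, satisfies `K ∩ 𝔪 ^ (q + 1) P ⊆ 𝔪 ^
q K` for all `q` (`lind_le_iff`). It then suffices to show that this condition holds in each degree
for `N` over `R` if and only if it holds over `S`.

A minimal cover `R ^ b ⟶ N` with kernel `K` factors through a minimal cover `S ^ b ⟶ N` with kernel
`K'`, giving `0 ⟶ J ⟶ K ⟶ K' ⟶ 0`, where `J` is the first `R`-syzygy of `S ^ b`. As `S` is Koszul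
over `R`, all syzygies of `J` satisfy the condition, and the `𝔪`-adic filtration of `K` induces that
of `J`. For such strict sequences the horseshoe construction yields minimal covers and again a
strict sequence of kernels, so `K` and `K'` satisfy the same conditions over `R`
(`IsStrictExact.syzygyCond_iff`). Induction on the degree, applied to the `S`-module `K'`, passes
from `R` to `S` (`syzygyCond_iff_of_koszul_aux`). -/

namespace LinearityDefect

universe u v w

/-! ### Comparing the `𝔪`-adic filtration of a submodule with the induced one -/

section KerCond

variable {R : Type*} [CommRing R]

theorem map_mem_smul {P Q : Type*} [AddCommGroup P] [Module R P] [AddCommGroup Q] [Module R Q]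
    {I : Ideal R} (f : P →ₗ[R] Q) {N : Submodule R P} {N' : Submodule R Q} (h : N.map f ≤ N')
    {x : P} (hx : x ∈ I • N) : f x ∈ I • N' := by
  have h1 := Submodule.mem_map_of_mem (f := f) hx
  rw [Submodule.map_smul''] at h1
  exact smul_mono_right I h h1

theorem map_mem_smul_top {P Q : Type*} [AddCommGroup P] [Module R P] [AddCommGroup Q]
    [Module R Q] {I : Ideal R} (f : P →ₗ[R] Q)
    {x : P} (hx : x ∈ I • (⊤ : Submodule R P)) : f x ∈ I • (⊤ : Submodule R Q) :=
  map_mem_smul f le_top hx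

theorem exists_mem_smul_of_mem_smul_map {P Q : Type*} [AddCommGroup P] [Module R P]
    [AddCommGroup Q] [Module R Q] {I : Ideal R} (f : P →ₗ[R] Q) {N : Submodule R P} {y : Q}
    (hy : y ∈ I • N.map f) : ∃ x ∈ I • N, f x = y := by
  rwa [← Submodule.map_smul''] at hy

theorem exists_mem_smul_top {P Q : Type*} [AddCommGroup P] [Module R P]
    [AddCommGroup Q] [Module R Q] {I : Ideal R} (f : P →ₗ[R] Q) (hf : Function.Surjective f)
    {y : Q} (hy : y ∈ I • (⊤ : Submodule R Q)) :
    ∃ x ∈ I • (⊤ : Submodule R P), f x = y := by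
  apply exists_mem_smul_of_mem_smul_map
  rwa [Submodule.map_top, LinearMap.range_eq_top.2 hf]

theorem map_ker_of_comp_eq {P P' M : Type*} [AddCommGroup P] [Module R P]
    [AddCommGroup P'] [Module R P'] [AddCommGroup M] [Module R M] {p : P →ₗ[R] M}
    {p' : P' →ₗ[R] M} {e : P ≃ₗ[R] P'} (he : p' ∘ₗ e.toLinearMap = p) :
    (LinearMap.ker p).map e.toLinearMap = LinearMap.ker p' := by
  rw [← he, LinearMap.ker_comp, Submodule.map_comap_eq_of_surjective e.surjective]

theorem mk_mem_smul_top {P Q : Type*} [AddCommGroup P] [Module R P] [AddCommGroup Q] [Module R Q]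
    {I : Ideal R} {x : P} {y : Q} (hx : x ∈ I • (⊤ : Submodule R P))
    (hy : y ∈ I • (⊤ : Submodule R Q)) : (x, y) ∈ I • (⊤ : Submodule R (P × Q)) := by
  simpa using add_mem (map_mem_smul_top (LinearMap.inl R P Q) hx)
    (map_mem_smul_top (LinearMap.inr R P Q) hy)

variable [IsLocalRing R]

/-- The condition `K ∩ 𝔪 ^ (q + 1) P ⊆ 𝔪 ^ q K` for all `q`. If `P` is a free cover of `M` with
kernel `K`, it says that `Tor₁ (R ⧸ 𝔪 ^ (q + 1), M) ⟶ Tor₁ (R ⧸ 𝔪 ^ q, M)` vanishes for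
all `q`. -/
def KerCond {P : Type*} [AddCommGroup P] [Module R P] (K : Submodule R P) : Prop :=
  ∀ q : ℕ, ∀ x ∈ K, x ∈ maximalIdeal R ^ (q + 1) • (⊤ : Submodule R P) →
    x ∈ maximalIdeal R ^ q • K

/-- The converse inclusion to `KerCond`: for `K ⊆ 𝔪 P` the two together say that the filtration
induced from `P` is the `𝔪`-adic one of `K`, shifted by one. -/
theorem mem_pow_succ_smul_top {P : Type*} [AddCommGroup P] [Module R P] {K : Submodule R P}
    (hK : K ≤ maximalIdeal R • ⊤) {q : ℕ} {x : P} (hx : x ∈ maximalIdeal R ^ q • K) :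
    x ∈ maximalIdeal R ^ (q + 1) • (⊤ : Submodule R P) := by
  rw [pow_succ, mul_smul]
  exact smul_mono_right _ hK hx

theorem KerCond.map_equiv {P Q : Type*} [AddCommGroup P] [Module R P] [AddCommGroup Q]
    [Module R Q] {K : Submodule R P} (h : KerCond K) (e : P ≃ₗ[R] Q) :
    KerCond (K.map (e : P →ₗ[R] Q)) := by
  rintro q _ ⟨x, hx, rfl⟩ h2
  refine map_mem_smul (e : P →ₗ[R] Q) le_rfl (h q x hx ?_)
  simpa using map_mem_smul_top (e.symm : Q →ₗ[R] P) h2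

/-- `hlift` pushes the condition forward; conversely, `x` is corrected by an element of `𝔪 ^ q • K`
with the same image, and `hker` handles the difference. Used for the horseshoe cover and for the
change of rings. -/
theorem kerCond_map_iff {P Q : Type*} [AddCommGroup P] [Module R P] [AddCommGroup Q]
    [Module R Q] {K : Submodule R P} (f : P →ₗ[R] Q) (hK : K ≤ maximalIdeal R • ⊤)
    (hker : ∀ q : ℕ, ∀ x ∈ K, f x = 0 → x ∈ maximalIdeal R ^ (q + 1) • (⊤ : Submodule R P) →
      x ∈ maximalIdeal R ^ q • K)
    (hlift : ∀ q : ℕ, ∀ y ∈ K.map f, y ∈ maximalIdeal R ^ (q + 1) • (⊤ : Submodule R Q) →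
      ∃ x ∈ K, x ∈ maximalIdeal R ^ (q + 1) • (⊤ : Submodule R P) ∧ f x = y) :
    KerCond K ↔ KerCond (K.map f) := by
  constructor
  · intro h q y hy hy2
    obtain ⟨x, hx, hx2, rfl⟩ := hlift q y hy hy2
    exact map_mem_smul f le_rfl (h q x hx hx2)
  · intro h q x hx hx2
    obtain ⟨z, hz, hzx⟩ := exists_mem_smul_of_mem_smul_map f
      (h q (f x) (Submodule.mem_map_of_mem hx) (map_mem_smul_top f hx2))
    have h3 := hker q (x - z) (sub_mem hx (Submodule.smul_le_right hz))
      (by rw [map_sub, hzx, sub_self]) (sub_mem hx2 (mem_pow_succ_smul_top hK hz))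
    simpa using add_mem h3 hz

end KerCond

/-! ### Linearity defect in terms of syzygies -/

namespace MinimalFreeResolution

variable {R : Type u} [CommRing R] [IsLocalRing R] {M : Type v} [AddCommGroup M] [Module R M]
  (F : MinimalFreeResolution R M)

theorem not_nontrivial_linHomology_succ_iff (i : ℕ) :
    ¬ Nontrivial (F.linHomology (i + 1)) ↔
      ∀ n, LinearMap.ker (F.grD n i) ≤ LinearMap.range (F.grD n (i + 1)) := by
  rw [not_nontrivial_iff_subsingleton, Submodule.Quotient.subsingleton_iff,
    Submodule.submoduleOf_eq_top]
  change LinearMap.ker (F.linD i) ≤ LinearMap.range (F.linD (i + 1)) ↔ _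
  rw [linD, linD, DirectSum.ker_lmap, DirectSum.range_lmap]
  constructor
  · intro h n z hz
    have := @h (DirectSum.lof R ℕ (fun n => F.gr n (i + 1)) n z) (by
      classical
      intro k _
      by_cases hk : k = n
      · subst hk
        simpa using hz
      · simp [DirectSum.lof_eq_of, DirectSum.of_eq_of_ne _ _ _ hk])
    simpa using this n trivial
  · intro h y hy n _
    exact h n (hy n trivial)

theorem ker_grD_le_range_iff (n i : ℕ) :
    LinearMap.ker (F.grD n i) ≤ LinearMap.range (F.grD n (i + 1)) ↔
      ∀ x ∈ F.filtration n (i + 1), F.d i x ∈ F.filtration (n + 1) i →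
        ∃ y ∈ F.filtration n (i + 2), x - F.d (i + 1) y ∈ F.filtration (n + 1) (i + 1) := by
  constructor
  · intro h x hx hdx
    obtain ⟨y, hy⟩ := @h (Submodule.Quotient.mk ⟨x, hx⟩)
      ((Submodule.Quotient.mk_eq_zero ((F.filtration (n + 1) i).submoduleOf (F.filtration n i))).2 hdx)
    obtain ⟨y, rfl⟩ := Submodule.Quotient.mk_surjective _ y
    exact ⟨y, y.2, (Submodule.Quotient.eq ((F.filtration (n + 1) (i + 1)).submoduleOf (F.filtration n (i + 1)))).1 hy.symm⟩
  · intro h x hx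
    obtain ⟨x, rfl⟩ := Submodule.Quotient.mk_surjective _ x
    obtain ⟨y, hy, hxy⟩ := h x x.2 ((Submodule.Quotient.mk_eq_zero ((F.filtration (n + 1) i).submoduleOf (F.filtration n i))).1 hx)
    exact ⟨Submodule.Quotient.mk ⟨y, hy⟩, ((Submodule.Quotient.eq ((F.filtration (n + 1) (i + 1)).submoduleOf (F.filtration n (i + 1)))).2 hxy).symm⟩

theorem forall_linHomology_iff (d : ℕ) :
    (∀ i, Nontrivial (F.linHomology i) → i ≤ d) ↔
      ∀ j, d ≤ j → KerCond (LinearMap.range (F.d j)) := by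
  -- Exactness of the linear part at `F (j + 1)`, written on representatives with `p = n - (j + 1)`.
  have key : (∀ i, Nontrivial (F.linHomology i) → i ≤ d) ↔ ∀ j, d ≤ j → ∀ p : ℕ,
      ∀ x ∈ maximalIdeal R ^ p • (⊤ : Submodule R (Fin (F.rank (j + 1)) → R)),
      F.d j x ∈ maximalIdeal R ^ (p + 2) • (⊤ : Submodule R (Fin (F.rank j) → R)) →
      ∃ y ∈ maximalIdeal R ^ (p - 1) • (⊤ : Submodule R (Fin (F.rank (j + 2)) → R)),
        x - F.d (j + 1) y ∈
          maximalIdeal R ^ (p + 1) • (⊤ : Submodule R (Fin (F.rank (j + 1)) → R)) := by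
    have h1 : (∀ i, Nontrivial (F.linHomology i) → i ≤ d) ↔
        ∀ j, d ≤ j → ¬ Nontrivial (F.linHomology (j + 1)) := by
      constructor
      · intro h j hj hn
        have := h _ hn
        omega
      · intro h i hi
        by_contra! hlt
        obtain ⟨j, rfl⟩ := Nat.exists_eq_succ_of_ne_zero (by omega : i ≠ 0)
        exact h j (by omega) hi
    rw [h1]
    refine forall₂_congr fun j _ => ?_
    rw [not_nontrivial_linHomology_succ_iff]
    simp only [ker_grD_le_range_iff, filtration]
    constructor
    · intro h p
      have := h (p + (j + 1))
      rwa [show p + (j + 1) - (j + 1) = p by omega,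
        show p + (j + 1) + 1 - j = p + 2 by omega,
        show p + (j + 1) - (j + 2) = p - 1 by omega,
        show p + (j + 1) + 1 - (j + 1) = p + 1 by omega] at this
    · intro h n
      -- For `n < j + 1` the next filtration step is still all of `F (j + 1)`, so there is nothing
      -- to correct.
      rcases lt_or_ge n (j + 1) with hn | hn
      · intro x _ _
        refine ⟨0, zero_mem _, ?_⟩
        rw [show n + 1 - (j + 1) = 0 by omega, pow_zero, Ideal.one_eq_top, Submodule.top_smul]
        trivial
      · obtain ⟨p, rfl⟩ := Nat.exists_eq_add_of_le' hn
        rw [show p + (j + 1) - (j + 1) = p by omega,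
          show p + (j + 1) + 1 - j = p + 2 by omega,
          show p + (j + 1) - (j + 2) = p - 1 by omega,
          show p + (j + 1) + 1 - (j + 1) = p + 1 by omega]
        exact h p
  rw [key]
  have hdd : ∀ j y, F.d j (F.d (j + 1) y) = 0 := fun j y =>
    (F.exact_succ j).apply_apply_eq_zero y
  constructor
  · rintro h j hj q _ ⟨x, rfl⟩ hx
    -- Modifying `x` by boundaries raises its order one step at a time without changing its image.
    have h2 : ∀ r, r ≤ q → ∃ z ∈ maximalIdeal R ^ r • (⊤ : Submodule R (Fin (F.rank (j + 1)) → R)),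
        F.d j z = F.d j x := by
      intro r
      induction r with
      | zero =>
        refine fun _ => ⟨x, ?_, rfl⟩
        rw [pow_zero, Ideal.one_eq_top, Submodule.top_smul]
        trivial
      | succ r ih =>
        intro hr
        obtain ⟨z, hz, hzx⟩ := ih (by omega)
        obtain ⟨y, -, hy⟩ := h j hj r z hz (by
          rw [hzx]
          exact Submodule.smul_mono_left (Ideal.pow_le_pow_right (by omega)) hx)
        exact ⟨_, hy, by rw [map_sub, hdd, sub_zero, hzx]⟩
    obtain ⟨z, hz, hzx⟩ := h2 q le_rfl
    rw [← hzx]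
    exact map_mem_smul (F.d j) (Submodule.map_top _).le hz
  · intro h j hj p x hx hdx
    -- The condition in degree `j` replaces `x` by some `w` of order `p + 1` with the same image;
    -- the condition in degree `j + 1` then bounds the order of a preimage of `x - w`.
    have h1 := h j hj (p + 1) _ ⟨x, rfl⟩ hdx
    rw [← Submodule.map_top] at h1
    obtain ⟨w, hw, hwx⟩ := exists_mem_smul_of_mem_smul_map _ h1
    have h2 : x - w ∈ LinearMap.range (F.d (j + 1)) :=
      (F.exact_succ j (x - w)).1 (by rw [map_sub, hwx, sub_self])
    have h3 : x - w ∈ maximalIdeal R ^ (p - 1) • LinearMap.range (F.d (j + 1)) := by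
      -- For `p = 0` the truncated exponent `p - 1` is `0`, and being a boundary is enough.
      cases p with
      | zero => simpa using h2
      | succ p =>
        exact h (j + 1) (by omega) p _ h2 (sub_mem hx
          (Submodule.smul_mono_left (Ideal.pow_le_pow_right (by omega)) hw))
    rw [← Submodule.map_top] at h3
    obtain ⟨y, hy, hyx⟩ := exists_mem_smul_of_mem_smul_map _ h3
    exact ⟨y, hy, by rw [hyx, sub_sub_cancel]; exact hw⟩

end MinimalFreeResolution

/-- The `j`-th syzygy of `M` satisfies `KerCond` in its minimal free cover. Equivalently, the maps
`Torⱼ₊₁ (R ⧸ 𝔪 ^ (q + 1), M) ⟶ Torⱼ₊₁ (R ⧸ 𝔪 ^ q, M)` vanish. -/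
def SyzygyCond (R : Type u) [CommRing R] [IsLocalRing R] (j : ℕ)
    (M : Type v) [AddCommGroup M] [Module R M] : Prop :=
  ∀ F : MinimalFreeResolution R M, KerCond (LinearMap.range (F.d j))

theorem lind_le_iff (R : Type u) [CommRing R] [IsLocalRing R]
    (M : Type v) [AddCommGroup M] [Module R M] (d : ℕ) :
    lind R M ≤ d ↔ ∀ j, d ≤ j → SyzygyCond R j M := by
  rw [lind, sSup_le_iff]
  constructor
  · intro h j hj F
    exact (F.forall_linHomology_iff d).1
      (fun i hi => by simpa using h i ⟨F, i, hi, rfl⟩) j hj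
  · rintro h _ ⟨F, i, hi, rfl⟩
    exact_mod_cast (F.forall_linHomology_iff d).2 (fun j hj => h j hj F) i hi

theorem lind_eq_of_forall_syzygyCond_iff {R : Type u} [CommRing R] [IsLocalRing R]
    {M : Type v} [AddCommGroup M] [Module R M] {S : Type*} [CommRing S] [IsLocalRing S]
    {N : Type*} [AddCommGroup N] [Module S N] (h : ∀ j, SyzygyCond R j M ↔ SyzygyCond S j N) :
    lind R M = lind S N := by
  have h2 : ∀ d : ℕ, lind R M ≤ d ↔ lind S N ≤ d := fun d => by
    simp only [lind_le_iff, h]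
  refine le_antisymm ?_ ?_
  · cases h3 : lind S N using ENat.recTopCoe with
    | top => exact le_top
    | coe d => exact (h2 d).2 h3.le
  · cases h3 : lind R M using ENat.recTopCoe with
    | top => exact le_top
    | coe d => exact (h2 d).1 h3.le

/-! ### Minimal covers and dimension shifting -/

section

variable {R : Type u} [CommRing R] [IsLocalRing R]

namespace MinimalFreeResolution

variable {M : Type v} [AddCommGroup M] [Module R M]

/-- Transport of a minimal free resolution along an isomorphism. -/
def congr {M' : Type w} [AddCommGroup M'] [Module R M'] (F : MinimalFreeResolution R M)
    (e : M ≃ₗ[R] M') : MinimalFreeResolution R M' where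
  rank := F.rank
  d := F.d
  aug := e.toLinearMap ∘ₗ F.aug
  aug_surjective := e.surjective.comp F.aug_surjective
  exact_zero := LinearMap.exact_iff.2 <| by
    rw [LinearEquiv.ker_comp]
    exact LinearMap.exact_iff.1 F.exact_zero
  exact_succ := F.exact_succ
  minimal := F.minimal

theorem ker_aug (F : MinimalFreeResolution R M) :
    LinearMap.ker F.aug = LinearMap.range (F.d 0) :=
  LinearMap.exact_iff.1 F.exact_zero

/-- The minimal free resolution of the first syzygy obtained by dropping `F 0`. -/
def shift (F : MinimalFreeResolution R M) : MinimalFreeResolution R (LinearMap.ker F.aug) where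
  rank n := F.rank (n + 1)
  d n := F.d (n + 1)
  aug := (F.d 0).codRestrict _ fun x => F.exact_zero.apply_apply_eq_zero x
  aug_surjective := by
    rintro ⟨x, hx⟩
    obtain ⟨y, hy⟩ := (F.exact_zero x).1 hx
    exact ⟨y, Subtype.ext hy⟩
  exact_zero := LinearMap.exact_iff.2 
    ((LinearMap.ker_codRestrict _ _ _).trans (LinearMap.exact_iff.1 (F.exact_succ 0)))
  exact_succ n := F.exact_succ (n + 1)
  minimal n := F.minimal (n + 1)

/-- The minimal free resolution of `M` obtained by splicing a minimal free cover of `M` with a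
minimal free resolution of its kernel. -/
def splice {b : ℕ} (p : (Fin b → R) →ₗ[R] M) (hp : Function.Surjective p)
    (hker : LinearMap.ker p ≤ maximalIdeal R • (⊤ : Submodule R (Fin b → R)))
    (F : MinimalFreeResolution R (LinearMap.ker p)) : MinimalFreeResolution R M where
  rank
    | 0 => b
    | n + 1 => F.rank n
  d
    | 0 => (LinearMap.ker p).subtype ∘ₗ F.aug
    | n + 1 => F.d n
  aug := p
  aug_surjective := hp
  exact_zero := LinearMap.exact_iff.2 <| by
    rw [LinearMap.range_comp, LinearMap.range_eq_top.2 F.aug_surjective, Submodule.map_top,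
      Submodule.range_subtype]
  exact_succ
    | 0 => LinearMap.exact_iff.2 <| by
      rw [LinearMap.ker_comp, Submodule.ker_subtype, Submodule.comap_bot]
      exact F.ker_aug
    | n + 1 => F.exact_succ n
  minimal
    | 0 => (LinearMap.range_comp_le_range _ _).trans ((Submodule.range_subtype _).trans_le hker)
    | n + 1 => F.minimal n

end MinimalFreeResolution

/-- A surjection whose kernel is contained in `𝔪 P`. -/
def IsMinimalCover {P M : Type*} [AddCommGroup P] [Module R P] [AddCommGroup M] [Module R M]
    (p : P →ₗ[R] M) : Prop :=
  Function.Surjective p ∧ LinearMap.ker p ≤ maximalIdeal R • (⊤ : Submodule R P)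

theorem MinimalFreeResolution.isMinimalCover_aug {M : Type*} [AddCommGroup M] [Module R M]
    (F : MinimalFreeResolution R M) : IsMinimalCover F.aug :=
  ⟨F.aug_surjective, F.ker_aug.trans_le (F.minimal 0)⟩

theorem IsMinimalCover.surjective_of_comp_surjective {P P' M : Type*} [AddCommGroup P]
    [Module R P] [AddCommGroup P'] [Module R P'] [Module.Finite R P'] [AddCommGroup M] [Module R M]
    {p' : P' →ₗ[R] M} (hp' : IsMinimalCover p') (f : P →ₗ[R] P')
    (hf : Function.Surjective (p' ∘ₗ f)) : Function.Surjective f := by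
  rw [← LinearMap.range_eq_top, eq_top_iff]
  refine Submodule.le_of_le_smul_of_le_jacobson_bot Module.Finite.fg_top
    (maximalIdeal_le_jacobson ⊥) fun y _ => ?_
  obtain ⟨x, hx⟩ := hf (p' y)
  rw [← add_sub_cancel (f x) y]
  refine Submodule.add_mem_sup ⟨x, rfl⟩ (hp'.2 ?_)
  rw [LinearMap.mem_ker, map_sub, ← hx, LinearMap.comp_apply, sub_self]

/-- Lifts in both directions are surjective by Nakayama, and a surjective endomorphism of a finite
module is injective. -/
theorem IsMinimalCover.exists_equiv {P P' M : Type*} [AddCommGroup P] [Module R P]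
    [Module.Finite R P] [Module.Projective R P] [AddCommGroup P'] [Module R P'] [Module.Finite R P']
    [Module.Projective R P'] [AddCommGroup M] [Module R M]
    {p : P →ₗ[R] M} {p' : P' →ₗ[R] M} (hp : IsMinimalCover p) (hp' : IsMinimalCover p') :
    ∃ e : P ≃ₗ[R] P', p' ∘ₗ e.toLinearMap = p := by
  obtain ⟨f, hf⟩ := Module.projective_lifting_property p' p hp'.1
  obtain ⟨g, hg⟩ := Module.projective_lifting_property p p' hp.1
  have hfs := hp'.surjective_of_comp_surjective f (hf ▸ hp.1)
  have hgs := hp.surjective_of_comp_surjective g (hg ▸ hp'.1)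
  have hinj : Function.Injective (g ∘ₗ f) :=
    OrzechProperty.injective_of_surjective_endomorphism _ (hgs.comp hfs)
  exact ⟨LinearEquiv.ofBijective f ⟨Function.Injective.of_comp hinj, hfs⟩, hf⟩

theorem IsMinimalCover.kerCond_iff {P P' M : Type*} [AddCommGroup P] [Module R P]
    [Module.Finite R P] [Module.Projective R P] [AddCommGroup P'] [Module R P'] [Module.Finite R P']
    [Module.Projective R P'] [AddCommGroup M] [Module R M]
    {p : P →ₗ[R] M} {p' : P' →ₗ[R] M} (hp : IsMinimalCover p) (hp' : IsMinimalCover p') :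
    KerCond (LinearMap.ker p) ↔ KerCond (LinearMap.ker p') := by
  obtain ⟨e, he⟩ := hp.exists_equiv hp'
  obtain ⟨e', he'⟩ := hp'.exists_equiv hp
  exact ⟨fun h => map_ker_of_comp_eq he ▸ h.map_equiv e,
    fun h => map_ker_of_comp_eq he' ▸ h.map_equiv e'⟩

theorem IsMinimalCover.nonempty_ker_equiv {P P' M : Type*} [AddCommGroup P] [Module R P]
    [Module.Finite R P] [Module.Projective R P] [AddCommGroup P'] [Module R P'] [Module.Finite R P']
    [Module.Projective R P'] [AddCommGroup M] [Module R M]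
    {p : P →ₗ[R] M} {p' : P' →ₗ[R] M} (hp : IsMinimalCover p) (hp' : IsMinimalCover p') :
    Nonempty (LinearMap.ker p ≃ₗ[R] LinearMap.ker p') := by
  obtain ⟨e, he⟩ := hp.exists_equiv hp'
  exact ⟨(e.submoduleMap _).trans (LinearEquiv.ofEq _ _ (map_ker_of_comp_eq he))⟩

theorem SyzygyCond.congr {M : Type v} [AddCommGroup M] [Module R M] {M' : Type w}
    [AddCommGroup M'] [Module R M'] {j : ℕ} (h : SyzygyCond R j M) (e : M ≃ₗ[R] M') :
    SyzygyCond R j M' :=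
  fun F => h (F.congr e.symm)

theorem syzygyCond_congr {M : Type v} [AddCommGroup M] [Module R M] {M' : Type w}
    [AddCommGroup M'] [Module R M'] {j : ℕ} (e : M ≃ₗ[R] M') :
    SyzygyCond R j M ↔ SyzygyCond R j M' :=
  ⟨fun h => h.congr e, fun h => h.congr e.symm⟩

section Noetherian

variable [IsNoetherianRing R] {P : Type w} [AddCommGroup P] [Module R P] [Module.Finite R P]
  [Module.Free R P] {M : Type v} [AddCommGroup M] [Module R M] {p : P →ₗ[R] M}

theorem IsMinimalCover.syzygyCond_zero_iff (hp : IsMinimalCover p) :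
    SyzygyCond R 0 M ↔ KerCond (LinearMap.ker p) := by
  have := Module.Finite.of_surjective p hp.1
  constructor
  · intro h
    obtain ⟨F⟩ := nonempty_minimalFreeResolution R M
    refine (F.isMinimalCover_aug.kerCond_iff hp).1 ?_
    rw [F.ker_aug]
    exact h F
  · intro h F
    rw [← F.ker_aug]
    exact (F.isMinimalCover_aug.kerCond_iff hp).2 h

/-- `shift` and `splice` convert between resolutions of `M` and of its first syzygy; uniqueness of
minimal covers allows any cover `p`. -/
theorem IsMinimalCover.syzygyCond_succ_iff (hp : IsMinimalCover p) (j : ℕ) :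
    SyzygyCond R (j + 1) M ↔ SyzygyCond R j (LinearMap.ker p) := by
  have := Module.Finite.of_surjective p hp.1
  constructor
  · intro h F
    obtain ⟨G⟩ := nonempty_minimalFreeResolution R M
    obtain ⟨e⟩ := hp.nonempty_ker_equiv G.isMinimalCover_aug
    exact h (.splice G.aug G.isMinimalCover_aug.1 G.isMinimalCover_aug.2 (F.congr e))
  · intro h F
    obtain ⟨e⟩ := F.isMinimalCover_aug.nonempty_ker_equiv hp
    exact h (F.shift.congr e)

end Noetherian

theorem exists_isMinimalCover (M : Type v) [AddCommGroup M] [Module R M] [Module.Finite R M] :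
    ∃ (b : ℕ) (p : (Fin b → R) →ₗ[R] M), IsMinimalCover p :=
  exists_minimal_cover R M

end

/-! ### Strict exact sequences and the horseshoe construction -/

section

variable {R : Type u} [CommRing R] [IsLocalRing R]

/-- A short exact sequence `0 ⟶ A ⟶ K ⟶ M ⟶ 0` such that the `𝔪`-adic filtration of `K` restricts
to the `𝔪`-adic filtration of `A`. -/
structure IsStrictExact {A K M : Type*} [AddCommGroup A] [Module R A] [AddCommGroup K] [Module R K]
    [AddCommGroup M] [Module R M] (f : A →ₗ[R] K) (g : K →ₗ[R] M) : Prop where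
  injective : Function.Injective f
  exact : Function.Exact f g
  surjective : Function.Surjective g
  strict (q : ℕ) (a : A) : f a ∈ maximalIdeal R ^ q • (⊤ : Submodule R K) →
    a ∈ maximalIdeal R ^ q • (⊤ : Submodule R A)

section Horseshoe

variable {A K M P Q : Type*} [AddCommGroup A] [Module R A] [AddCommGroup K] [Module R K]
  [AddCommGroup M] [Module R M] [AddCommGroup P] [Module R P] [AddCommGroup Q] [Module R Q]
  {f : A →ₗ[R] K} {g : K →ₗ[R] M} {p : P →ₗ[R] A} {r : Q →ₗ[R] M} {l : Q →ₗ[R] K}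

/-- Minimality uses strictness at `q = 1`: if `f (p x) = -l y` with `y ∈ 𝔪 Q`, then `p x ∈ 𝔪 A`. -/
theorem IsStrictExact.isMinimalCover_coprod (h : IsStrictExact f g) (hp : IsMinimalCover p)
    (hr : IsMinimalCover r) (hl : g ∘ₗ l = r) : IsMinimalCover ((f ∘ₗ p).coprod l) := by
  have hl' : ∀ y, g (l y) = r y := fun y => LinearMap.congr_fun hl y
  constructor
  · intro k
    obtain ⟨y, hy⟩ := hr.1 (g k)
    obtain ⟨a, ha⟩ := (h.exact (k - l y)).1 (by rw [map_sub, hl', hy, sub_self])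
    obtain ⟨x, rfl⟩ := hp.1 a
    exact ⟨(x, y), by simp [ha]⟩
  · rintro ⟨x, y⟩ hxy
    have hxy' : f (p x) + l y = 0 := by simpa using hxy
    have hy : y ∈ maximalIdeal R • (⊤ : Submodule R Q) := by
      refine hr.2 ?_
      have := congrArg g hxy'
      rwa [map_add, h.exact.apply_apply_eq_zero, zero_add, hl', map_zero] at this
    have hx : p x ∈ maximalIdeal R • (⊤ : Submodule R A) := by
      have := h.strict 1 (p x)
      rw [pow_one] at this
      refine this ?_
      rw [eq_neg_of_add_eq_zero_left hxy']
      exact neg_mem (map_mem_smul_top l hy)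
    obtain ⟨x', hx', hxx⟩ := exists_mem_smul_top p hp.1 hx
    refine mk_mem_smul_top ?_ hy
    have : x - x' ∈ maximalIdeal R • (⊤ : Submodule R P) :=
      hp.2 (by rw [LinearMap.mem_ker, map_sub, hxx, sub_self])
    simpa using add_mem this hx'

/-- Strictness propagates to the kernels: an element of `ker p` lying in `𝔪 ^ q` times the middle
kernel has order at least `q + 1` in `P`, so `hA` applies. -/
theorem IsStrictExact.exists_ker (h : IsStrictExact f g) (hp : IsMinimalCover p)
    (hr : IsMinimalCover r) (hl : g ∘ₗ l = r) (hA : KerCond (LinearMap.ker p)) :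
    ∃ (f' : LinearMap.ker p →ₗ[R] LinearMap.ker ((f ∘ₗ p).coprod l))
      (g' : LinearMap.ker ((f ∘ₗ p).coprod l) →ₗ[R] LinearMap.ker r), IsStrictExact f' g' := by
  have hl' : ∀ y, g (l y) = r y := fun y => LinearMap.congr_fun hl y
  have hK := (h.isMinimalCover_coprod hp hr hl).2
  refine ⟨(LinearMap.inl R P Q).restrict fun x hx => ?_,
    (LinearMap.snd R P Q).restrict fun x hx => ?_, ?_, ?_, ?_, ?_⟩
  · have : p x = 0 := hx
    simp [this]
  · have := congrArg g (show f (p x.1) + l x.2 = 0 by simpa using hx)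
    rwa [map_add, h.exact.apply_apply_eq_zero, zero_add, hl', map_zero] at this
  · intro x y hxy
    exact Subtype.ext (congrArg (fun z : LinearMap.ker ((f ∘ₗ p).coprod l) => z.1.1) hxy)
  · rintro ⟨⟨x, y⟩, hxy⟩
    constructor
    · intro hy
      obtain rfl : y = 0 := congrArg Subtype.val hy
      have hx : f (p x) = 0 := by simpa using hxy
      exact ⟨⟨x, h.injective (by rw [hx, map_zero])⟩, rfl⟩
    · rintro ⟨z, hz⟩
      exact Subtype.ext
        (congrArg (fun z : LinearMap.ker ((f ∘ₗ p).coprod l) => z.1.2) hz).symm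
  · rintro ⟨y, hy⟩
    obtain ⟨a, ha⟩ := (h.exact (l y)).1 (by rw [hl']; exact hy)
    obtain ⟨x, rfl⟩ := hp.1 a
    exact ⟨⟨(-x, y), by simp [ha]⟩, rfl⟩
  · rintro q ⟨x, hx⟩ hxq
    rw [Submodule.mem_smul_top_iff] at hxq ⊢
    exact hA q x hx (map_mem_smul_top (LinearMap.fst R P Q) (mem_pow_succ_smul_top hK hxq))

theorem IsStrictExact.kerCond_coprod_iff (h : IsStrictExact f g) (hp : IsMinimalCover p)
    (hr : IsMinimalCover r) (hl : g ∘ₗ l = r) (hA : KerCond (LinearMap.ker p)) :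
    KerCond (LinearMap.ker ((f ∘ₗ p).coprod l)) ↔ KerCond (LinearMap.ker r) := by
  have hl' : ∀ y, g (l y) = r y := fun y => LinearMap.congr_fun hl y
  have hK := (h.isMinimalCover_coprod hp hr hl).2
  have hmap : (LinearMap.ker ((f ∘ₗ p).coprod l)).map (LinearMap.snd R P Q) = LinearMap.ker r := by
    ext y
    constructor
    · rintro ⟨⟨x, y⟩, hx, rfl⟩
      have := congrArg g (show f (p x) + l y = 0 by simpa using hx)
      rwa [map_add, h.exact.apply_apply_eq_zero, zero_add, hl', map_zero] at this
    · intro hy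
      obtain ⟨a, ha⟩ := (h.exact (l y)).1 (by rw [hl']; exact hy)
      obtain ⟨x, rfl⟩ := hp.1 a
      exact ⟨(-x, y), by simp [ha], rfl⟩
  rw [← hmap]
  refine kerCond_map_iff _ hK ?_ ?_
  · rintro q ⟨x, y⟩ hx hy hxq
    obtain rfl : y = 0 := hy
    have hx' : f (p x) = 0 := by simpa using hx
    have hpx : p x = 0 := h.injective (by rw [hx', map_zero])
    refine map_mem_smul (LinearMap.inl R P Q) ?_
      (hA q x hpx (map_mem_smul_top (LinearMap.fst R P Q) hxq))
    rintro _ ⟨z, hz, rfl⟩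
    have : p z = 0 := hz
    simp [this]
  · intro q y hy hyq
    rw [hmap] at hy
    -- Strictness at `q + 1` lets the first coordinate of the lift be chosen of the same order as
    -- `y`.
    obtain ⟨a, ha⟩ := (h.exact (l y)).1 (by rw [hl']; exact hy)
    obtain ⟨x, hx, rfl⟩ := exists_mem_smul_top p hp.1
      (h.strict (q + 1) a (ha ▸ map_mem_smul_top l hyq))
    exact ⟨(-x, y), by simp [ha], mk_mem_smul_top (neg_mem hx) hyq, rfl⟩

end Horseshoe

variable [IsNoetherianRing R]

/-- The induction needs a single universe. After one horseshoe step all modules are submodules of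
free `R`-modules, so `IsStrictExact.syzygyCond_iff` does that step by hand and then applies this
version. -/
theorem IsStrictExact.syzygyCond_iff_aux (j : ℕ) : ∀ {A K M : Type u} [AddCommGroup A] [Module R A]
    [Module.Finite R A] [AddCommGroup K] [Module R K] [AddCommGroup M]
    [Module R M] [Module.Finite R M] {f : A →ₗ[R] K} {g : K →ₗ[R] M} (_ : IsStrictExact f g)
    (_ : ∀ j, SyzygyCond R j A), SyzygyCond R j K ↔ SyzygyCond R j M := by
  induction j with
  | zero =>
    intro A K M _ _ _ _ _ _ _ _ f g h hA
    obtain ⟨a, p, hp⟩ := exists_isMinimalCover (R := R) A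
    obtain ⟨c, r, hr⟩ := exists_isMinimalCover (R := R) M
    obtain ⟨l, hl⟩ := Module.projective_lifting_property g r h.surjective
    rw [(h.isMinimalCover_coprod hp hr hl).syzygyCond_zero_iff, hr.syzygyCond_zero_iff]
    exact h.kerCond_coprod_iff hp hr hl (hp.syzygyCond_zero_iff.1 (hA 0))
  | succ j ih =>
    intro A K M _ _ _ _ _ _ _ _ f g h hA
    obtain ⟨a, p, hp⟩ := exists_isMinimalCover (R := R) A
    obtain ⟨c, r, hr⟩ := exists_isMinimalCover (R := R) M
    obtain ⟨l, hl⟩ := Module.projective_lifting_property g r h.surjective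
    rw [(h.isMinimalCover_coprod hp hr hl).syzygyCond_succ_iff, hr.syzygyCond_succ_iff]
    obtain ⟨f', g', h'⟩ := h.exists_ker hp hr hl (hp.syzygyCond_zero_iff.1 (hA 0))
    exact ih h' fun j => (hp.syzygyCond_succ_iff j).1 (hA (j + 1))

theorem IsStrictExact.syzygyCond_iff {A K M : Type*} [AddCommGroup A] [Module R A]
    [Module.Finite R A] [AddCommGroup K] [Module R K] [AddCommGroup M]
    [Module R M] [Module.Finite R M] {f : A →ₗ[R] K} {g : K →ₗ[R] M} (h : IsStrictExact f g)
    (hA : ∀ j, SyzygyCond R j A) (j : ℕ) : SyzygyCond R j K ↔ SyzygyCond R j M := by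
  obtain ⟨a, p, hp⟩ := exists_isMinimalCover (R := R) A
  obtain ⟨c, r, hr⟩ := exists_isMinimalCover (R := R) M
  obtain ⟨l, hl⟩ := Module.projective_lifting_property g r h.surjective
  have hK := h.isMinimalCover_coprod hp hr hl
  have hp0 := hp.syzygyCond_zero_iff.1 (hA 0)
  cases j with
  | zero =>
    rw [hK.syzygyCond_zero_iff, hr.syzygyCond_zero_iff]
    exact h.kerCond_coprod_iff hp hr hl hp0
  | succ j =>
    rw [hK.syzygyCond_succ_iff, hr.syzygyCond_succ_iff]
    obtain ⟨f', g', h'⟩ := h.exists_ker hp hr hl hp0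
    exact h'.syzygyCond_iff_aux j fun j => (hp.syzygyCond_succ_iff j).1 (hA (j + 1))

theorem SyzygyCond.of_subsingleton {M : Type*} [AddCommGroup M] [Module R M] [Subsingleton M]
    (j : ℕ) : SyzygyCond R j M := by
  suffices h : SyzygyCond R j (Fin 0 → R) from h.congr (LinearEquiv.ofSubsingleton _ _)
  have hp : IsMinimalCover (LinearMap.id : (Fin 0 → R) →ₗ[R] (Fin 0 → R)) :=
    ⟨fun x => ⟨x, rfl⟩, fun x _ => Subsingleton.elim 0 x ▸ zero_mem _⟩
  induction j with
  | zero => exact hp.syzygyCond_zero_iff.2 fun q x _ _ => Subsingleton.elim 0 x ▸ zero_mem _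
  | succ j ih => exact (hp.syzygyCond_succ_iff j).2 (ih.congr (LinearEquiv.ofSubsingleton _ _))

theorem SyzygyCond.prod {A B : Type*} [AddCommGroup A] [Module R A] [Module.Finite R A]
    [AddCommGroup B] [Module R B] [Module.Finite R B] (hA : ∀ j, SyzygyCond R j A)
    (hB : ∀ j, SyzygyCond R j B) (j : ℕ) : SyzygyCond R j (A × B) := by
  have h : IsStrictExact (LinearMap.inl R A B) (LinearMap.snd R A B) :=
    ⟨LinearMap.inl_injective, .inl_snd, LinearMap.snd_surjective,
      fun q a ha => map_mem_smul_top (LinearMap.fst R A B) ha⟩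
  exact (h.syzygyCond_iff hA j).2 (hB j)

theorem SyzygyCond.pi_fin {A : Type*} [AddCommGroup A] [Module R A] [Module.Finite R A]
    (hA : ∀ j, SyzygyCond R j A) (n j : ℕ) : SyzygyCond R j (Fin n → A) := by
  induction n generalizing j with
  | zero => exact .of_subsingleton j
  | succ n ih =>
    exact (SyzygyCond.prod hA ih j).congr (Fin.consLinearEquiv R fun _ => A)

end

theorem exists_equiv_quotient (R : Type u) [CommRing R] (M : Type w) [AddCommGroup M] [Module R M]
    [Module.Finite R M] :
    ∃ (n : ℕ) (K : Submodule R (Fin n → R)), Nonempty (((Fin n → R) ⧸ K) ≃ₗ[R] M) := by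
  obtain ⟨n, f, hf⟩ := Module.Finite.exists_fin' R M
  exact ⟨n, LinearMap.ker f, ⟨f.quotKerEquivOfSurjective hf⟩⟩

theorem lind_congr {R : Type*} [CommRing R] [IsLocalRing R] {M : Type*} [AddCommGroup M]
    [Module R M] {M' : Type*} [AddCommGroup M'] [Module R M'] (e : M ≃ₗ[R] M') :
    lind R M = lind R M' :=
  lind_eq_of_forall_syzygyCond_iff fun _ => syzygyCond_congr e

/-! ### Change of rings along a surjection -/

section BaseChange

variable {R : Type*} [CommRing R] {S : Type*} [CommRing S] [Algebra R S]

theorem finite_of_surjective_algebraMap (hsurj : Function.Surjective (algebraMap R S))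
    (N : Type*) [AddCommGroup N] [Module R N] [Module S N] [IsScalarTower R S N]
    [Module.Finite S N] : Module.Finite R N :=
  have : Module.Finite R S := Module.Finite.of_surjective (Algebra.linearMap R S) hsurj
  Module.Finite.trans S N

/-- The componentwise map `R ^ b ⟶ S ^ b`. -/
abbrev piAlgebraMap (R S : Type*) [CommRing R] [CommRing S] [Algebra R S] (b : ℕ) :
    (Fin b → R) →ₗ[R] (Fin b → S) :=
  (Algebra.linearMap R S).compLeft (Fin b)

theorem piAlgebraMap_surjective (hsurj : Function.Surjective (algebraMap R S)) (b : ℕ) :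
    Function.Surjective (piAlgebraMap R S b) :=
  fun y => ⟨fun i => (hsurj (y i)).choose, funext fun i => (hsurj (y i)).choose_spec⟩

theorem exists_factor_piAlgebraMap {N : Type*} [AddCommGroup N] [Module R N] [Module S N]
    [IsScalarTower R S N] {b : ℕ} (p : (Fin b → R) →ₗ[R] N) :
    ∃ p' : (Fin b → S) →ₗ[S] N, p'.restrictScalars R ∘ₗ piAlgebraMap R S b = p := by
  refine ⟨Fintype.linearCombination S fun i => p (Pi.single i 1), LinearMap.pi_ext' fun i =>
    LinearMap.ext_ring ?_⟩
  classical
  simp [Fintype.linearCombination_apply, Pi.single_apply, apply_ite]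

section Factor

variable {N : Type*} [AddCommGroup N] [Module R N] [Module S N] [IsScalarTower R S N] {b : ℕ}
  {p : (Fin b → R) →ₗ[R] N} {p' : (Fin b → S) →ₗ[S] N}

theorem ker_piAlgebraMap_le (hpp : p'.restrictScalars R ∘ₗ piAlgebraMap R S b = p) :
    LinearMap.ker (piAlgebraMap R S b) ≤ LinearMap.ker p :=
  hpp ▸ LinearMap.ker_le_ker_comp _ _

theorem map_piAlgebraMap_ker (hsurj : Function.Surjective (algebraMap R S))
    (hpp : p'.restrictScalars R ∘ₗ piAlgebraMap R S b = p) :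
    (LinearMap.ker p).map (piAlgebraMap R S b) = (LinearMap.ker p').restrictScalars R := by
  rw [← hpp, LinearMap.ker_comp,
    Submodule.map_comap_eq_of_surjective (piAlgebraMap_surjective hsurj b)]
  rfl

variable [IsLocalRing R]

theorem isMinimalCover_piAlgebraMap (hsurj : Function.Surjective (algebraMap R S))
    (hp : IsMinimalCover p)
    (hpp : p'.restrictScalars R ∘ₗ piAlgebraMap R S b = p) :
    IsMinimalCover (piAlgebraMap R S b) :=
  ⟨piAlgebraMap_surjective hsurj b, (ker_piAlgebraMap_le hpp).trans hp.2⟩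

end Factor

variable [IsLocalRing R] [IsLocalRing S]

/-- `𝔪_S` is the extension of `𝔪_R`, so the two adic filtrations of an `S`-module agree. -/
theorem restrictScalars_maximalIdeal_pow_smul (hsurj : Function.Surjective (algebraMap R S))
    {P : Type*} [AddCommGroup P] [Module R P] [Module S P] [IsScalarTower R S P] (q : ℕ)
    (K : Submodule S P) : (maximalIdeal S ^ q • K).restrictScalars R =
      maximalIdeal R ^ q • K.restrictScalars R := by
  rw [← map_maximalIdeal_of_surjective (algebraMap R S) hsurj, ← Ideal.map_pow,
    Ideal.smul_restrictScalars]

theorem kerCond_restrictScalars_iff (hsurj : Function.Surjective (algebraMap R S))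
    {P : Type*} [AddCommGroup P] [Module R P] [Module S P] [IsScalarTower R S P]
    (K : Submodule S P) : KerCond (K.restrictScalars R) ↔ KerCond K := by
  refine forall_congr' fun q => forall₂_congr fun x _ => ?_
  rw [← restrictScalars_maximalIdeal_pow_smul hsurj, ← Submodule.restrictScalars_top R S P,
    ← restrictScalars_maximalIdeal_pow_smul hsurj]
  rfl

section Factor

variable {N : Type*} [AddCommGroup N] [Module R N] [Module S N] [IsScalarTower R S N] {b : ℕ}
  {p : (Fin b → R) →ₗ[R] N} {p' : (Fin b → S) →ₗ[S] N}

theorem IsMinimalCover.factor (hsurj : Function.Surjective (algebraMap R S))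
    (hp : IsMinimalCover p) (hpp : p'.restrictScalars R ∘ₗ piAlgebraMap R S b = p) :
    IsMinimalCover p' := by
  constructor
  · intro y
    obtain ⟨x, rfl⟩ := hp.1 y
    exact ⟨piAlgebraMap R S b x, LinearMap.congr_fun hpp x⟩
  · intro y hy
    have hy' : y ∈ (LinearMap.ker p).map (piAlgebraMap R S b) := by
      rw [map_piAlgebraMap_ker hsurj hpp]
      exact hy
    obtain ⟨x, hx, rfl⟩ := hy'
    have h1 := map_mem_smul_top (piAlgebraMap R S b) (hp.2 hx)
    have h2 := restrictScalars_maximalIdeal_pow_smul hsurj 1 (⊤ : Submodule S (Fin b → S))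
    rw [pow_one, pow_one, Submodule.restrictScalars_top] at h2
    rw [← h2] at h1
    exact h1

theorem kerCond_iff_of_factor (hsurj : Function.Surjective (algebraMap R S))
    (hJ : KerCond (LinearMap.ker (piAlgebraMap R S b))) (hp : IsMinimalCover p)
    (hpp : p'.restrictScalars R ∘ₗ piAlgebraMap R S b = p) :
    KerCond (LinearMap.ker p) ↔ KerCond (LinearMap.ker p') := by
  rw [← kerCond_restrictScalars_iff hsurj, ← map_piAlgebraMap_ker hsurj hpp]
  refine kerCond_map_iff _ hp.2 (fun q x _ hx hxq => ?_) fun q y hy hyq => ?_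
  · exact smul_mono_right _ (ker_piAlgebraMap_le hpp) (hJ q x hx hxq)
  -- Any lift of `y` lies in `ker p`, the full preimage of `ker p'`, so one of order `q + 1` may be
  -- chosen.
  · obtain ⟨x, hx, rfl⟩ := exists_mem_smul_top _ (piAlgebraMap_surjective hsurj b) hyq
    obtain ⟨z, hz, hzx⟩ := hy
    refine ⟨x, ?_, hx, rfl⟩
    have hz' : p z = 0 := hz
    rw [LinearMap.mem_ker, ← hz', ← hpp, LinearMap.comp_apply, LinearMap.comp_apply, hzx]

theorem exists_isStrictExact_of_factor (hsurj : Function.Surjective (algebraMap R S))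
    (hJ : KerCond (LinearMap.ker (piAlgebraMap R S b))) (hp : IsMinimalCover p)
    (hpp : p'.restrictScalars R ∘ₗ piAlgebraMap R S b = p) :
    ∃ (f : LinearMap.ker (piAlgebraMap R S b) →ₗ[R] LinearMap.ker p)
      (g : LinearMap.ker p →ₗ[R] LinearMap.ker p'), IsStrictExact f g := by
  refine ⟨Submodule.inclusion (ker_piAlgebraMap_le hpp),
    ((piAlgebraMap R S b).restrict (q := (LinearMap.ker p').restrictScalars R) fun x hx => ?_ :),
    ?_, ?_, ?_, ?_⟩
  · rw [← map_piAlgebraMap_ker hsurj hpp]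
    exact Submodule.mem_map_of_mem hx
  · exact Submodule.inclusion_injective _
  · rintro ⟨x, hx⟩
    constructor
    · intro h
      exact ⟨⟨x, congrArg Subtype.val h⟩, rfl⟩
    · rintro ⟨⟨z, hz⟩, h⟩
      obtain rfl : z = x := congrArg Subtype.val h
      exact Subtype.ext hz
  · rintro ⟨y, hy⟩
    have hy' : y ∈ (LinearMap.ker p).map (piAlgebraMap R S b) := by
      rw [map_piAlgebraMap_ker hsurj hpp]
      exact hy
    obtain ⟨x, hx, rfl⟩ := hy'
    exact ⟨⟨x, hx⟩, rfl⟩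
  · rintro q ⟨x, hx⟩ hxq
    rw [Submodule.mem_smul_top_iff] at hxq ⊢
    exact hJ q x hx (mem_pow_succ_smul_top hp.2 hxq)

end Factor

end BaseChange

/-! ### Comparison of linearity defects over `R` and `S` -/

section Main

variable {R : Type u} [CommRing R] [IsLocalRing R] [IsNoetherianRing R]
  {S : Type v} [CommRing S] [IsLocalRing S] [IsNoetherianRing S] [Algebra R S]

theorem syzygyCond_iff_of_koszul_aux (hsurj : Function.Surjective (algebraMap R S))
    (hS : ∀ j, SyzygyCond R j S) (j : ℕ) : ∀ (N : Type v) [AddCommGroup N] [Module R N]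
    [Module S N] [IsScalarTower R S N] [Module.Finite S N],
    SyzygyCond R j N ↔ SyzygyCond S j N := by
  have := finite_of_surjective_algebraMap hsurj S
  induction j with
  | zero =>
    intro N _ _ _ _ _
    have := finite_of_surjective_algebraMap hsurj N
    obtain ⟨b, p, hp⟩ := exists_isMinimalCover (R := R) N
    obtain ⟨p', hpp⟩ := exists_factor_piAlgebraMap (S := S) p
    have hJ := isMinimalCover_piAlgebraMap hsurj hp hpp
    rw [hp.syzygyCond_zero_iff, (hp.factor hsurj hpp).syzygyCond_zero_iff]
    exact kerCond_iff_of_factor hsurj (hJ.syzygyCond_zero_iff.1 (.pi_fin hS b 0)) hp hpp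
  | succ j ih =>
    intro N _ _ _ _ _
    have := finite_of_surjective_algebraMap hsurj N
    obtain ⟨b, p, hp⟩ := exists_isMinimalCover (R := R) N
    obtain ⟨p', hpp⟩ := exists_factor_piAlgebraMap (S := S) p
    have hJ := isMinimalCover_piAlgebraMap hsurj hp hpp
    rw [hp.syzygyCond_succ_iff, (hp.factor hsurj hpp).syzygyCond_succ_iff]
    obtain ⟨f, g, h⟩ := exists_isStrictExact_of_factor hsurj
      (hJ.syzygyCond_zero_iff.1 (.pi_fin hS b 0)) hp hpp
    have := finite_of_surjective_algebraMap hsurj (LinearMap.ker p')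
    rw [h.syzygyCond_iff fun j => (hJ.syzygyCond_succ_iff j).1 (.pi_fin hS b (j + 1))]
    exact ih _

theorem lind_eq_of_koszul (hsurj : Function.Surjective (algebraMap R S)) (hS : lind R S = 0)
    (N : Type*) [AddCommGroup N] [Module R N] [Module S N] [IsScalarTower R S N]
    [Module.Finite S N] : lind R N = lind S N := by
  have hS' : ∀ j, SyzygyCond R j S := fun j =>
    (lind_le_iff R S 0).1 (by simp [hS]) j (Nat.zero_le j)
  -- A quotient of `S ^ n` lives in the universe of `S`, where the induction was carried out.
  obtain ⟨n, K, ⟨e⟩⟩ := exists_equiv_quotient S N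
  refine lind_eq_of_forall_syzygyCond_iff fun j => ?_
  rw [← syzygyCond_congr e, ← syzygyCond_congr (e.restrictScalars R)]
  exact syzygyCond_iff_of_koszul_aux hsurj hS' j _

theorem exists_lind_eq (hsurj : Function.Surjective (algebraMap R S)) (hS : lind R S = 0)
    (N : Type*) [AddCommGroup N] [Module S N] [Module.Finite S N] :
    ∃ M : ModuleCat.{u} R, Module.Finite R M ∧ lind R M = lind S N := by
  let _ : Module R N := Module.compHom N (algebraMap R S)
  have : IsScalarTower R S N := ⟨fun r s x => by
    rw [Algebra.smul_def, mul_smul]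
    rfl⟩
  have := finite_of_surjective_algebraMap hsurj N
  obtain ⟨n, K, ⟨e⟩⟩ := exists_equiv_quotient R N
  exact ⟨ModuleCat.of R _, inferInstanceAs (Module.Finite R ((Fin n → R) ⧸ K)),
    (lind_congr e).trans (lind_eq_of_koszul hsurj hS N)⟩

end Main

end LinearityDefect

theorem theorem5p2 {R : Type*} {S : Type*}
    [CommRing R] [IsLocalRing R] [IsNoetherianRing R]
    [CommRing S] [IsLocalRing S] [IsNoetherianRing S]
    [Algebra R S] (hsurj : Function.Surjective (algebraMap R S))
    (hS : LinearityDefect.lind R S = 0) :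
    (∀ (N : Type*) [AddCommGroup N] [Module R N] [Module S N] [IsScalarTower R S N],
      Module.Finite S N → LinearityDefect.lind R N = LinearityDefect.lind S N) ∧
    LinearityDefect.glind S ≤ LinearityDefect.glind R ∧
    (LinearityDefect.IsAbsolutelyKoszul R → LinearityDefect.IsAbsolutelyKoszul S) := by
  refine ⟨fun N _ _ _ _ _ => LinearityDefect.lind_eq_of_koszul hsurj hS N, ?_, fun hR N _ _ _ => ?_⟩
  · refine sSup_le ?_
    rintro _ ⟨N, hN, rfl⟩
    obtain ⟨M, hM, h⟩ := LinearityDefect.exists_lind_eq hsurj hS N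
    exact le_sSup ⟨M, hM, h.symm⟩
  · obtain ⟨M, hM, h⟩ := LinearityDefect.exists_lind_eq hsurj hS N
    exact h ▸ hR M hM
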